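/- Let $\mathcal{A}$ be a complex Banach algebra with identity. For a ring $R$ with identity, call $a\in R$ quasinilpotent if $1+ax$ is invertible for every $x\in R$ with $xa=ax$; call $a$ g-Drazin invertible if there is $b\in R$ with $ab=ba$, $b=bab$ and $a-a^2b$ quasinilpotent. In $\mathcal{A}$ and in $M_2(\mathcal{A})$ such a $b$ is unique; write $a^d=b$ and $a^\pi=1-aa^d$. Theorem 3.3. Let $A,B,C,D\in\mathcal{A}$, let $0\neq\lambda\in\mathbb{C}$, and put $$M=\begin{pmatrix}A&B\\C&D\end{pmatrix},\quad P=\begin{pmatrix}A&0\\0&D\end{pmatrix},\quad Q=\begin{pmatrix}0&B\\C&0\end{pmatrix}\in M_2(\mathcal{A}).$$ Suppose that $A$, $D$ and $BC$ are g-Drazin invertible (then so is $CB$), and that $$AB=\lambda A^\pi BD(CB)^\pi,\qquad DC=\lambda D^\pi CA(BC)^\pi .$$ Then $P$, $Q$ and $M$ are g-Drazin invertible in $M_2(\mathcal{A})$, and $$\begin{aligned}M^d={}&\begin{pmatrix}(BC)^\pi A^d & B(CB)^dD^\pi\\ C(BC)^dA^\pi & (CB)^\pi D^d\end{pmatrix}+\sum_{n=0}^\infty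 (Q^d)^{n+2}PM^nP^\pi+Q^\pi\sum_{n=0}^\infty M^nQ(P^d)^{n+2}\\&-\sum_{n=0}^\infty\sum_{k=0}^\infty (Q^d)^{k+1}PM^{n+k}Q(P^d)^{n+2}-\sum_{n=0}^\infty (Q^d)^{n+2}PM^nQP^d,\end{aligned}$$ where all the series converge unconditionally in $M_2(\mathcal{A})$ (the double series as a series indexed by the pairs $(n,k)$). -/

import Mathlib

namespace GDrazin

/-- `a` is quasinilpotent: `1 + a x` is invertible for every `x` in the commutant of `a`. -/
def Quasinilpotent {R : Type*} [Ring R] (a : R) : Prop :=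
  ∀ x : R, x * a = a * x → IsUnit (1 + a * x)

/-- `b` is a g-Drazin inverse of `a`: `b` lies in the commutant of `a`, `b = b a b`, and
`a - a² b` is quasinilpotent. -/
def IsGDrazinInverse {R : Type*} [Ring R] (a b : R) : Prop :=
  b * a = a * b ∧ b = b * a * b ∧ Quasinilpotent (a - a ^ 2 * b)

/-- `a` has a g-Drazin inverse. -/
def GDrazinInvertible {R : Type*} [Ring R] (a : R) : Prop :=
  ∃ b : R, IsGDrazinInverse a b

open Classical in
/-- The g-Drazin inverse of `a` (and `0` if there is none). It is unique in a complex Banach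
algebra and in the ring of square matrices over one: see `gDrazinInv_eq` and
`gDrazinInv_eq_matrix`. -/
noncomputable def gDrazinInv {R : Type*} [Ring R] (a : R) : R :=
  if h : GDrazinInvertible a then h.choose else 0

/-- The spectral idempotent `1 - a a^d`. -/
noncomputable def spectralIdempotent {R : Type*} [Ring R] (a : R) : R :=
  1 - a * gDrazinInv a

theorem gDrazinInv_spec {R : Type*} [Ring R] {a : R} (h : GDrazinInvertible a) :
    IsGDrazinInverse a (gDrazinInv a) := by
  rw [gDrazinInv, dif_pos h]
  exact h.choose_spec

/-- In a complex Banach algebra, `cⁿ ‖wⁿ‖ → 0` for `w` quasinilpotent, so a fixed element whose norm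
is bounded by all `cⁿ ‖wⁿ‖` vanishes. -/
theorem eq_zero_of_norm_le {A : Type*} [NormedRing A] [NormedAlgebra ℂ A] [CompleteSpace A]
    {w z : A} (hw : Quasinilpotent w) (c : ℝ) (hc : 0 ≤ c)
    (hz : ∀ n : ℕ, 1 ≤ n → ‖z‖ ≤ c ^ n * ‖w ^ n‖) : z = 0 := by
  have hr : spectralRadius ℂ w = 0 := by
    rw [spectralRadius]
    simp only [ENNReal.iSup_eq_zero]
    intro k hk
    by_contra hne
    have hk0 : k ≠ 0 := by
      rintro rfl
      simp at hne
    apply hk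
    have h1 := hw (algebraMap ℂ A (-k⁻¹)) (Algebra.commutes _ _)
    have h2 : algebraMap ℂ A k - w = algebraMap ℂ A k * (1 + w * algebraMap ℂ A (-k⁻¹)) := by
      rw [← Algebra.commutes (-k⁻¹) w, mul_add, ← mul_assoc, ← map_mul]
      simp [hk0, sub_eq_add_neg]
    rw [spectrum.mem_resolventSet_iff, h2]
    exact ((IsUnit.mk0 k hk0).map (algebraMap ℂ A)).mul h1
  have ht := spectrum.pow_norm_pow_one_div_tendsto_nhds_spectralRadius w
  rw [hr] at ht
  have hε : (0 : ENNReal) < ENNReal.ofReal (1 / (2 * (c + 1))) := by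
    rw [ENNReal.ofReal_pos]; positivity
  have hev := (ht.eventually (gt_mem_nhds hε)).and (Filter.eventually_ge_atTop 1)
  have hlim : Filter.Tendsto (fun n : ℕ => (1 / 2 : ℝ) ^ n) Filter.atTop (nhds 0) :=
    tendsto_pow_atTop_nhds_zero_of_lt_one (by norm_num) (by norm_num)
  have hle : ‖z‖ ≤ 0 := by
    refine ge_of_tendsto hlim ?_
    filter_upwards [hev] with n hn
    obtain ⟨hn, h1⟩ := hn
    have hpos : (0 : ℝ) < 1 / (2 * (c + 1)) := by positivity
    have hlt : ‖w ^ n‖ ^ (1 / n : ℝ) < 1 / (2 * (c + 1)) :=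
      (ENNReal.ofReal_lt_ofReal_iff hpos).1 hn
    have hn0 : n ≠ 0 := by omega
    have hpow : ‖w ^ n‖ ≤ (1 / (2 * (c + 1))) ^ n := by
      have h3 := pow_le_pow_left₀ (Real.rpow_nonneg (norm_nonneg (w ^ n)) _) hlt.le n
      rwa [one_div (n : ℝ), Real.rpow_inv_natCast_pow (norm_nonneg _) hn0] at h3
    calc ‖z‖ ≤ c ^ n * ‖w ^ n‖ := hz n h1
      _ ≤ c ^ n * (1 / (2 * (c + 1))) ^ n := by gcongr
      _ = (c / (2 * (c + 1))) ^ n := by rw [← mul_pow]; congr 1; ring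
      _ ≤ (1 / 2) ^ n := by
        refine pow_le_pow_left₀ (by positivity) ?_ n
        rw [div_le_div_iff₀ (by positivity) (by norm_num)]
        linarith
  exact norm_le_zero_iff.1 hle

/-- In a complex Banach algebra two g-Drazin inverses have mutually absorbing idempotents. -/
theorem idem_mul {A : Type*} [NormedRing A] [NormedAlgebra ℂ A] [CompleteSpace A]
    {a b c : A} (hb : IsGDrazinInverse a b) (hc : IsGDrazinInverse a c) :
    a * b * (a * c) = a * b ∧ a * c * (a * b) = a * b := by
  obtain ⟨b1, b2, -⟩ := hb
  obtain ⟨c1, c2, c3⟩ := hc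
  have hp : IsIdempotentElem (a * b) := by
    rw [IsIdempotentElem, mul_assoc, ← mul_assoc b, ← b2]
  have hq : IsIdempotentElem (1 - a * c) := by
    apply IsIdempotentElem.one_sub
    rw [IsIdempotentElem, mul_assoc, ← mul_assoc c, ← c2]
  have hab : Commute a b := b1.symm
  have haq : Commute a (1 - a * c) :=
    (Commute.one_right a).sub_right ((Commute.refl a).mul_right c1.symm)
  have hw : a - a ^ 2 * c = a * (1 - a * c) := by noncomm_ring
  rw [hw] at c3
  have hwn : ∀ n : ℕ, 1 ≤ n → (a * (1 - a * c)) ^ n = a ^ n * (1 - a * c) := fun n hn => by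
    rw [haq.mul_pow, hq.pow_eq (by omega)]
  have hpn : ∀ n : ℕ, 1 ≤ n → a * b = b ^ n * a ^ n := fun n hn => by
    rw [← hab.symm.mul_pow, b1, hp.pow_eq (by omega)]
  have hpn' : ∀ n : ℕ, 1 ≤ n → a * b = a ^ n * b ^ n := fun n hn => by
    rw [← hab.mul_pow, hp.pow_eq (by omega)]
  have hnb : ∀ n : ℕ, 1 ≤ n → ‖b ^ n‖ ≤ ‖b‖ ^ n := fun n hn => norm_pow_le' b (by omega)
  constructor
  · have h0 : a * b * (1 - a * c) = 0 := by
      refine eq_zero_of_norm_le c3 ‖b‖ (norm_nonneg _) fun n hn => ?_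
      have : a * b * (1 - a * c) = b ^ n * (a * (1 - a * c)) ^ n := by
        rw [hwn n hn, ← mul_assoc, ← hpn n hn]
      rw [this]
      exact (norm_mul_le _ _).trans (by gcongr; exact hnb n hn)
    rw [mul_sub, mul_one, sub_eq_zero] at h0
    exact h0.symm
  · have h0 : (1 - a * c) * (a * b) = 0 := by
      refine eq_zero_of_norm_le c3 ‖b‖ (norm_nonneg _) fun n hn => ?_
      have : (1 - a * c) * (a * b) = (a * (1 - a * c)) ^ n * b ^ n := by
        rw [hwn n hn, (haq.pow_left n).eq, mul_assoc, ← hpn' n hn]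
      rw [this, mul_comm (‖b‖ ^ n)]
      exact (norm_mul_le _ _).trans (by gcongr; exact hnb n hn)
    rw [sub_mul, one_mul, sub_eq_zero] at h0
    exact h0.symm

/-- Uniqueness of the g-Drazin inverse in a complex Banach algebra. -/
theorem IsGDrazinInverse.unique {A : Type*} [NormedRing A] [NormedAlgebra ℂ A] [CompleteSpace A]
    {a b c : A} (hb : IsGDrazinInverse a b) (hc : IsGDrazinInverse a c) : b = c := by
  have e : a * b = a * c := (idem_mul hb hc).1.symm.trans (idem_mul hc hb).2
  have hb2 := hb.2.1
  have hc2 := hc.2.1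
  calc b = b * a * b := hb2
    _ = b * a * c := by rw [mul_assoc, e, ← mul_assoc]
    _ = c * a * c := by rw [hb.1, e, hc.1]
    _ = c := hc2.symm

theorem gDrazinInv_eq {A : Type*} [NormedRing A] [NormedAlgebra ℂ A] [CompleteSpace A]
    {a b : A} (h : IsGDrazinInverse a b) : gDrazinInv a = b :=
  (gDrazinInv_spec ⟨b, h⟩).unique h

theorem gDrazinInv_eq_matrix {A : Type*} [NormedRing A] [NormedAlgebra ℂ A] [CompleteSpace A]
    {ι : Type*} [Fintype ι] [DecidableEq ι] {a b : Matrix ι ι A} (h : IsGDrazinInverse a b) :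
    gDrazinInv a = b := by
  have hcomp : CompleteSpace (Matrix ι ι A) := inferInstance
  exact @gDrazinInv_eq (Matrix ι ι A) Matrix.linftyOpNormedRing Matrix.linftyOpNormedAlgebra
    hcomp a b h

end GDrazin

/-! The two hypotheses are the off-diagonal entries of the single identity `P * Q = lam • (P^π Q P
Q^π)`. Such an identity is very rigid. Multiplying by `P^d` on the left or `Q^d` on the right gives
`P^d Q = 0` and `P Q^d = 0`, so it reduces to `P Q = lam • (Q P)`. Iterating this relation against
the quasinilpotent parts of `P` and `Q`, whose powers decay faster than any geometric sequence,
forces also `Q P^d = 0` and `Q^d P = 0`. Hence `M^d = P^d + Q^d` (`IsGDrazinInverse.add`), provided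
that the sum of the two quasinilpotent parts, which still commute up to `lam`, is quasinilpotent.
Every term of every series contains `Q^d P` or `Q P^d`, so all the series vanish; the leading matrix
is `P^d + Q^d`, because its spectral idempotents act trivially. -/

namespace GDrazin

/-! ### Quasinilpotency through the spectrum and the growth of powers -/

section Characterizations

variable {R : Type*} [NormedRing R] [CompleteSpace R]

theorem Quasinilpotent.notMem_spectrum {R : Type*} [Ring R] [Algebra ℂ R] {a : R}
    (ha : Quasinilpotent a) {k : ℂ} (hk : k ≠ 0) : k ∉ spectrum ℂ a := by
  have h1 := ha (algebraMap ℂ R (-k⁻¹)) (Algebra.commutes _ _)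
  have h2 : algebraMap ℂ R k - a = algebraMap ℂ R k * (1 + a * algebraMap ℂ R (-k⁻¹)) := by
    rw [← Algebra.commutes (-k⁻¹) a, mul_add, ← mul_assoc, ← map_mul]
    simp [hk, sub_eq_add_neg]
  rw [spectrum.notMem_iff, h2]
  exact ((IsUnit.mk0 k hk).map (algebraMap ℂ R)).mul h1

/-- If the spectrum of `a` contains no nonzero point, then `‖aⁿ‖` decays faster than any
geometric sequence. -/
theorem exists_norm_pow_le [NormedAlgebra ℂ R] {a : R}
    (ha : ∀ k : ℂ, k ≠ 0 → k ∉ spectrum ℂ a) {ε : ℝ} (hε : 0 < ε) :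
    ∃ K : ℝ, 0 ≤ K ∧ ∀ n : ℕ, ‖a ^ n‖ ≤ K * ε ^ n := by
  have hr : spectralRadius ℂ a = 0 := by
    rw [spectralRadius]
    simp only [ENNReal.iSup_eq_zero]
    intro k hk
    by_contra hne
    exact ha k (by rintro rfl; simp at hne) hk
  have ht := spectrum.pow_norm_pow_one_div_tendsto_nhds_spectralRadius a
  rw [hr] at ht
  have hev := (ht.eventually (gt_mem_nhds (ENNReal.ofReal_pos.2 hε))).and
    (Filter.eventually_ge_atTop 1)
  -- The ratio is eventually at most 1; the finitely many other exponents are absorbed into `K`.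
  have hb : Filter.IsBoundedUnder (· ≤ ·) Filter.atTop (fun n : ℕ => ‖a ^ n‖ / ε ^ n) := by
    refine ⟨1, Filter.eventually_map.2 ?_⟩
    filter_upwards [hev] with n hn
    obtain ⟨hn, h1⟩ := hn
    have hlt : ‖a ^ n‖ ^ (1 / n : ℝ) < ε := (ENNReal.ofReal_lt_ofReal_iff hε).1 hn
    have h3 := pow_le_pow_left₀ (Real.rpow_nonneg (norm_nonneg (a ^ n)) _) hlt.le n
    rw [one_div (n : ℝ), Real.rpow_inv_natCast_pow (norm_nonneg _) (by omega)] at h3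
    rwa [div_le_one (by positivity)]
  obtain ⟨K, hK⟩ := hb.bddAbove_range
  have hK' : ∀ n : ℕ, ‖a ^ n‖ / ε ^ n ≤ K := fun n => hK ⟨n, rfl⟩
  refine ⟨K, le_trans (by positivity) (hK' 0), fun n => ?_⟩
  rw [← div_le_iff₀ (by positivity)]
  exact hK' n

/-- For `x` commuting with `a`, the powers of `-a x` tend to 0, so some `1 - (-a x)^n` is a unit. It
factors as `1 + a x` times a geometric sum commuting with it, so `1 + a x` is a unit. -/
theorem quasinilpotent_of_norm_pow_le {a : R}
    (ha : ∀ ε : ℝ, 0 < ε → ∃ K : ℝ, ∀ n : ℕ, ‖a ^ n‖ ≤ K * ε ^ n) : Quasinilpotent a := by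
  intro x hx
  have hc : Commute a (-x) := (show Commute a x from hx.symm).neg_right
  obtain ⟨K, hK⟩ := ha (1 / (2 * (‖x‖ + 1))) (by positivity)
  have hbound : ∀ n : ℕ, 1 ≤ n → ‖(a * -x) ^ n‖ ≤ |K| * (1 / 2) ^ n := fun n hn => by
    rw [hc.mul_pow]
    calc ‖a ^ n * (-x) ^ n‖ ≤ ‖a ^ n‖ * ‖(-x) ^ n‖ := norm_mul_le _ _
      _ ≤ (|K| * (1 / (2 * (‖x‖ + 1))) ^ n) * ‖x‖ ^ n := by
        gcongr
        · exact (hK n).trans (by gcongr; exact le_abs_self K)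
        · simpa using norm_pow_le' (-x) (by omega : 0 < n)
      _ = |K| * (‖x‖ / (2 * (‖x‖ + 1))) ^ n := by
        rw [mul_assoc, ← mul_pow]; congr 2; ring
      _ ≤ |K| * (1 / 2) ^ n := by
        refine mul_le_mul_of_nonneg_left (pow_le_pow_left₀ (by positivity) ?_ n) (abs_nonneg K)
        rw [div_le_div_iff₀ (by positivity) (by norm_num)]
        linarith
  have hlim : Filter.Tendsto (fun n : ℕ => |K| * (1 / 2 : ℝ) ^ n) Filter.atTop (nhds 0) := by
    simpa using (tendsto_pow_atTop_nhds_zero_of_lt_one (by norm_num : (0 : ℝ) ≤ 1 / 2)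
      (by norm_num)).const_mul |K|
  obtain ⟨n, hn, h1⟩ := ((hlim.eventually (gt_mem_nhds one_pos)).and
    (Filter.eventually_ge_atTop 1)).exists
  have hu : IsUnit (1 - (a * -x) ^ n) :=
    isUnit_one_sub_of_norm_lt_one ((hbound n h1).trans_lt hn)
  have hcomm : Commute (1 - a * -x) (∑ i ∈ Finset.range n, (a * -x) ^ i) :=
    Commute.sum_right _ _ _ fun i _ =>
      ((Commute.one_left _).sub_left ((Commute.refl _).pow_right i))
  rw [← mul_neg_geom_sum, hcomm.isUnit_mul_iff] at hu
  simpa using hu.1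

/-- In a complex Banach algebra an element is quasinilpotent as soon as its spectrum contains no
nonzero point. -/
theorem quasinilpotent_of_notMem_spectrum [NormedAlgebra ℂ R] {a : R}
    (ha : ∀ k : ℂ, k ≠ 0 → k ∉ spectrum ℂ a) :
    Quasinilpotent a :=
  quasinilpotent_of_norm_pow_le fun _ hε =>
    let ⟨K, _, hK⟩ := exists_norm_pow_le ha hε
    ⟨K, hK⟩

theorem Quasinilpotent.mul_swap [NormedAlgebra ℂ R] {a b : R} (h : Quasinilpotent (a * b)) :
    Quasinilpotent (b * a) := by
  refine quasinilpotent_of_notMem_spectrum fun k hk hmem => ?_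
  have h1 : k ∈ spectrum ℂ (b * a) \ {0} := ⟨hmem, hk⟩
  rw [spectrum.nonzero_mul_comm] at h1
  exact h.notMem_spectrum hk h1.1

theorem Quasinilpotent.of_sq {R : Type*} [Ring R] {a : R} (h : Quasinilpotent (a * a)) :
    Quasinilpotent a := by
  intro x hx
  have hc : Commute a x := hx.symm
  -- The test element `-x²` turns `1 + a² (-x²)` into a difference of squares.
  have h1 := h (-(x * x)) (((hc.mul_left hc).mul_right (hc.mul_left hc)).neg_right.symm)
  have h2 : 1 + a * a * -(x * x) = (1 + a * x) * (1 - a * x) := by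
    have : a * (x * (a * x)) = a * (a * (x * x)) := by rw [← mul_assoc x a x, hx, mul_assoc]
    simp only [mul_sub, add_mul, mul_one, one_mul, mul_neg, mul_assoc, this]
    abel
  have h3 : Commute (1 + a * x) (1 - a * x) :=
    ((Commute.one_left _).add_left ((Commute.one_right _).sub_right (Commute.refl _)))
  rw [h2, h3.isUnit_mul_iff] at h1
  exact h1.1

end Characterizations

/-! ### Sums under twisted commutation, and Cline's formula -/

section Sum

variable {R : Type*} [NormedRing R] [NormedAlgebra ℂ R]

theorem mul_prod_add_smul {u v : R} {lam : ℂ} (h : u * v = lam • (v * u)) (L : List ℂ) :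
    u * (L.map fun μ => u + μ • v).prod
      = ((L.map (lam * ·)).map fun μ => u + μ • v).prod * u := by
  induction L with
  | nil => simp
  | cons μ L ih =>
    have h1 : u * (u + μ • v) = (u + (lam * μ) • v) * u := by
      rw [mul_add, add_mul, mul_smul_comm, h, smul_mul_assoc, smul_smul, mul_comm μ lam]
    simp only [List.map_cons, List.prod_cons]
    rw [← mul_assoc, h1, mul_assoc, ih, mul_assoc]

/-- Expand the first factor `u + μ v`: its `v` joins the power on the left, and its `u` moves to the
far right, multiplying the later coefficients by `lam`, which keeps them in the unit disc. Each step
splits one term into two, whence the factor `2`. General lists and exponents `i`, `j` are needed for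
the induction. -/
theorem norm_pow_mul_prod_mul_pow_le {u v : R} {lam : ℂ} (h : u * v = lam • (v * u))
    (hlam : ‖lam‖ ≤ 1) {ε K K' : ℝ} (hε : 0 ≤ ε) (_hK0 : 0 ≤ K) (hK'0 : 0 ≤ K')
    (hK : ∀ n : ℕ, ‖u ^ n‖ ≤ K * ε ^ n) (hK' : ∀ n : ℕ, ‖v ^ n‖ ≤ K' * ε ^ n)
    (n : ℕ) (L : List ℂ) (hn : L.length = n) (hL : ∀ μ ∈ L, ‖μ‖ ≤ 1) (i j : ℕ) :
    ‖v ^ i * (L.map fun μ => u + μ • v).prod * u ^ j‖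
      ≤ K * K' * ε ^ (i + j) * (2 * ε) ^ n := by
  induction n generalizing L i j with
  | zero =>
    obtain rfl := List.length_eq_zero_iff.1 hn
    simp only [List.map_nil, List.prod_nil, mul_one, pow_zero]
    calc ‖v ^ i * u ^ j‖ ≤ ‖v ^ i‖ * ‖u ^ j‖ := norm_mul_le _ _
      _ ≤ (K' * ε ^ i) * (K * ε ^ j) := by gcongr <;> simp [hK, hK']
      _ = K * K' * ε ^ (i + j) := by ring
  | succ n ih =>
    obtain _ | ⟨μ, L⟩ := L
    · simp at hn
    have hn' : L.length = n := by simpa using hn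
    have hL' : ∀ ν ∈ L, ‖ν‖ ≤ 1 := fun ν hν => hL ν (List.mem_cons_of_mem _ hν)
    have e : v ^ i * ((μ :: L).map fun μ => u + μ • v).prod * u ^ j
        = v ^ i * ((L.map (lam * ·)).map fun μ => u + μ • v).prod * u ^ (j + 1)
          + μ • (v ^ (i + 1) * (L.map fun μ => u + μ • v).prod * u ^ j) := by
      rw [List.map_cons, List.prod_cons, add_mul, mul_prod_add_smul h, pow_succ' u, pow_succ v]
      simp only [mul_add, add_mul, smul_mul_assoc, mul_smul_comm, mul_assoc]
    have h1 := ih (L.map (lam * ·)) (by simpa using hn') (by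
      intro ν hν
      obtain ⟨ρ, hρ, rfl⟩ := List.mem_map.1 hν
      rw [norm_mul]
      exact mul_le_one₀ hlam (norm_nonneg _) (hL' ρ hρ)) i (j + 1)
    have h2 := ih L hn' hL' (i + 1) j
    have hμ : ‖μ‖ ≤ 1 := hL μ List.mem_cons_self
    rw [e]
    calc _ ≤ _ := norm_add_le _ _
      _ ≤ K * K' * ε ^ (i + (j + 1)) * (2 * ε) ^ n
          + 1 * (K * K' * ε ^ (i + 1 + j) * (2 * ε) ^ n) := by
        rw [norm_smul]
        gcongr
      _ = _ := by ring

theorem Quasinilpotent.add_of_norm_le_one [CompleteSpace R] {u v : R} {lam : ℂ}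
    (hu : Quasinilpotent u) (hv : Quasinilpotent v) (h : u * v = lam • (v * u))
    (hlam : ‖lam‖ ≤ 1) : Quasinilpotent (u + v) := by
  refine quasinilpotent_of_norm_pow_le fun ε hε => ?_
  obtain ⟨K, hK0, hK⟩ := exists_norm_pow_le (fun _ hk => hu.notMem_spectrum hk) (half_pos hε)
  obtain ⟨K', hK'0, hK'⟩ := exists_norm_pow_le (fun _ hk => hv.notMem_spectrum hk) (half_pos hε)
  refine ⟨K * K', fun n => ?_⟩
  have := norm_pow_mul_prod_mul_pow_le h hlam (half_pos hε).le hK0 hK'0 hK hK' n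
    (List.replicate n 1) (by simp) (fun μ hμ => by simp [List.eq_of_mem_replicate hμ]) 0 0
  simpa [mul_div_cancel₀] using this

/-- The sum of two quasinilpotent elements which commute up to a nonzero scalar factor is
quasinilpotent. -/
theorem Quasinilpotent.add_of_mul_eq_smul [CompleteSpace R] {u v : R} {lam : ℂ}
    (hu : Quasinilpotent u) (hv : Quasinilpotent v) (hlam : lam ≠ 0)
    (h : u * v = lam • (v * u)) : Quasinilpotent (u + v) := by
  rcases le_total ‖lam‖ 1 with h1 | h1
  · exact hu.add_of_norm_le_one hv h h1
  -- Exchanging the two summands replaces `lam` by its inverse.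
  · rw [add_comm]
    refine hv.add_of_norm_le_one hu (lam := lam⁻¹) ?_ ?_
    · rw [h, inv_smul_smul₀ hlam]
    · rw [norm_inv]
      exact inv_le_one_of_one_le₀ h1

theorem eq_zero_of_eq_smul_pow_mul [CompleteSpace R] {w z s t : R} (hw : Quasinilpotent w)
    (c : ℂ) (hz : ∀ n : ℕ, 1 ≤ n → z = c ^ n • (w ^ n * s * t ^ n)) : z = 0 := by
  -- The `+ 1` makes the single factor `‖s‖` at most an `n`-th power for every `n ≥ 1`.
  refine eq_zero_of_norm_le hw (‖c‖ * (‖s‖ + 1) * ‖t‖) (by positivity) fun n hn => ?_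
  have hs : ‖s‖ ≤ (‖s‖ + 1) ^ n :=
    (le_add_of_nonneg_right zero_le_one).trans
      (le_self_pow₀ (le_add_of_nonneg_left (norm_nonneg s)) (by omega))
  calc ‖z‖ = ‖c‖ ^ n * ‖w ^ n * s * t ^ n‖ := by rw [hz n hn, norm_smul, norm_pow]
    _ ≤ ‖c‖ ^ n * (‖w ^ n‖ * (‖s‖ + 1) ^ n * ‖t‖ ^ n) := by
      gcongr
      refine (norm_mul₃_le).trans ?_
      gcongr
      exact norm_pow_le' t (by omega)
    _ = _ := by rw [mul_pow, mul_pow]; ring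

theorem eq_zero_of_eq_smul_mul_pow [CompleteSpace R] {w z s t : R} (hw : Quasinilpotent w)
    (c : ℂ) (hz : ∀ n : ℕ, 1 ≤ n → z = c ^ n • (t ^ n * s * w ^ n)) : z = 0 := by
  refine eq_zero_of_norm_le hw (‖c‖ * (‖s‖ + 1) * ‖t‖) (by positivity) fun n hn => ?_
  have hs : ‖s‖ ≤ (‖s‖ + 1) ^ n :=
    (le_add_of_nonneg_right zero_le_one).trans
      (le_self_pow₀ (le_add_of_nonneg_left (norm_nonneg s)) (by omega))
  calc ‖z‖ = ‖c‖ ^ n * ‖t ^ n * s * w ^ n‖ := by rw [hz n hn, norm_smul, norm_pow]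
    _ ≤ ‖c‖ ^ n * (‖t‖ ^ n * (‖s‖ + 1) ^ n * ‖w ^ n‖) := by
      gcongr
      refine (norm_mul₃_le).trans ?_
      gcongr
      exact norm_pow_le' t (by omega)
    _ = _ := by rw [mul_pow, mul_pow]; ring

/-- If `ab = λ a^π b a b^π` then the g-Drazin inverses of `a` and `b` annihilate the other element
on both sides, and their sum is the g-Drazin inverse of `a + b`. -/
theorem IsGDrazinInverse.add [CompleteSpace R] {a b x y : R} {lam : ℂ} (hlam : lam ≠ 0)
    (ha : IsGDrazinInverse a x) (hb : IsGDrazinInverse b y)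
    (h : a * b = lam • ((1 - a * x) * b * a * (1 - b * y))) :
    b * x = 0 ∧ y * a = 0 ∧ IsGDrazinInverse (a + b) (x + y) := by
  obtain ⟨a1, a2, a3⟩ := ha
  obtain ⟨b1, b2, b3⟩ := hb
  have hx0 : x * (1 - a * x) = 0 := by rw [mul_sub, mul_one, ← mul_assoc, ← a2, sub_self]
  have hy0 : (1 - b * y) * y = 0 := by rw [sub_mul, one_mul, ← b1, ← b2, sub_self]
  have hxx : x = x * x * a := by rw [mul_assoc, a1, ← mul_assoc]; exact a2
  have hyy : y = b * y * y := by rw [← b1]; exact b2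
  have hxb : x * b = 0 := by
    -- Since `x = x² a`, the product `x b` equals `x² (a b)`, which contains `x (1 - a x) = 0`.
    have e : x * x * ((1 - a * x) * b * a * (1 - b * y))
        = x * (x * (1 - a * x)) * b * a * (1 - b * y) := by simp only [mul_assoc]
    rw [hxx, mul_assoc, h, mul_smul_comm, e, hx0]
    simp
  have hay : a * y = 0 := by
    rw [hyy, ← mul_assoc, ← mul_assoc, h]
    simp [mul_assoc _ _ y, hy0]
  have hab : a * b = lam • (b * a) := by
    have e1 : (1 - a * x) * b = b := by rw [sub_mul, mul_assoc, hxb]; simp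
    have e2 : a * (1 - b * y) = a := by rw [← b1, mul_sub, ← mul_assoc, hay]; simp
    rw [h, e1, mul_assoc, e2]
  have hu : (a - a ^ 2 * x) * b = a * b := by rw [sub_mul, mul_assoc, hxb]; simp
  have hv : a * (b - b ^ 2 * y) = a * b := by
    rw [sq, mul_assoc b b y, ← b1, ← mul_assoc b, ← b1, mul_sub, ← mul_assoc, ← mul_assoc, hay]
    simp
  have hun : ∀ n : ℕ, (a - a ^ 2 * x) ^ n * b = lam ^ n • (b * a ^ n) := fun n => by
    induction n with
    | zero => simp
    | succ n ih =>
      rw [pow_succ, mul_assoc, hu, hab, mul_smul_comm, ← mul_assoc, ih, smul_mul_assoc, smul_smul,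
        mul_assoc, ← pow_succ, pow_succ' lam]
  have hvn : ∀ n : ℕ, a * (b - b ^ 2 * y) ^ n = lam ^ n • (b ^ n * a) := fun n => by
    induction n with
    | zero => simp
    | succ n ih =>
      rw [pow_succ', ← mul_assoc, hv, hab, smul_mul_assoc, mul_assoc, ih, mul_smul_comm, smul_smul,
        ← mul_assoc, pow_succ' b, pow_succ' lam]
  have hpa : IsIdempotentElem (a * x) := by
    rw [IsIdempotentElem, mul_assoc, ← mul_assoc x, ← a2]
  have hpb : IsIdempotentElem (y * b) := by
    rw [IsIdempotentElem, ← mul_assoc, ← b2]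
  have hbax : b * (a * x) = 0 := by
    -- By idempotency `b (a x) = b aⁿ xⁿ`, and `hun` rewrites this as `lam⁻ⁿ wⁿ b xⁿ` with `w` the
    -- quasinilpotent part of `a`.
    refine eq_zero_of_eq_smul_pow_mul a3 lam⁻¹ (s := b) (t := x) fun n hn => ?_
    rw [hun, smul_mul_assoc, smul_smul, ← mul_pow, inv_mul_cancel₀ hlam, one_pow, one_smul,
      mul_assoc, ← (show Commute a x from a1.symm).mul_pow, hpa.pow_eq (by omega)]
  have hyba : y * b * a = 0 := by
    refine eq_zero_of_eq_smul_mul_pow b3 lam⁻¹ (s := a) (t := y) fun n hn => ?_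
    rw [mul_assoc (y ^ n), hvn, mul_smul_comm, smul_smul, ← mul_pow, inv_mul_cancel₀ hlam, one_pow,
      one_smul, ← mul_assoc, ← (show Commute y b from b1).mul_pow, hpb.pow_eq (by omega)]
  have hbx : b * x = 0 := by
    rw [a2, a1, ← mul_assoc, hbax, zero_mul]
  have hya : y * a = 0 := by
    rw [b2, mul_assoc y b y, ← b1, mul_assoc, hyba, mul_zero]
  have hres : a + b - (a + b) ^ 2 * (x + y) = (a - a ^ 2 * x) + (b - b ^ 2 * y) := by
    have e : (a + b) * (x + y) = a * x + b * y := by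
      simp [mul_add, add_mul, hbx, hay]
    rw [sq, mul_assoc, e]
    have e1 : a * (b * y) = 0 := by rw [← b1, ← mul_assoc, hay, zero_mul]
    simp only [add_mul, mul_add, e1, hbax, sq, mul_assoc]
    abel
  refine ⟨hbx, hya, ?_, ?_, ?_⟩
  · simp [mul_add, add_mul, hbx, hay, hxb, hya, a1, b1]
  · have e : (x + y) * (a + b) = x * a + y * b := by
      simp [mul_add, add_mul, hxb, hya]
    rw [e]
    have e1 : x * a * y = 0 := by rw [mul_assoc, hay, mul_zero]
    have e2 : y * b * x = 0 := by rw [mul_assoc, hbx, mul_zero]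
    simp [add_mul, mul_add, e1, e2, ← a2, ← b2]
  · rw [hres]
    -- The quasinilpotent parts have the same products, in both orders, as `a` and `b`.
    refine a3.add_of_mul_eq_smul b3 hlam ?_
    have e1 : (a - a ^ 2 * x) * (b - b ^ 2 * y) = a * b := by
      rw [← hv, sq b, mul_assoc, ← mul_one_sub, ← mul_assoc, hu, mul_assoc]
    have e2 : (b - b ^ 2 * y) * (a - a ^ 2 * x) = b * a := by
      have e3 : (b - b ^ 2 * y) * a = b * a := by rw [sub_mul, mul_assoc, hya]; simp
      have e4 : a - a ^ 2 * x = a * (1 - a * x) := by rw [mul_sub, sq, mul_one, mul_assoc]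
      rw [e4, ← mul_assoc, e3, mul_assoc, ← e4, mul_sub, sq, mul_assoc a a x, ← a1,
        ← mul_assoc a x a, ← a1, ← mul_assoc, ← mul_assoc, mul_assoc b, a1, hbax]
      simp
    rw [e1, e2, hab]

/-- Cline's formula. -/
theorem IsGDrazinInverse.mul_swap [CompleteSpace R] {b c p : R}
    (h : IsGDrazinInverse (b * c) p) : IsGDrazinInverse (c * b) (c * p * p * b) := by
  obtain ⟨h1, h2, h3⟩ := h
  have hpp : b * c * p * p = p := by rw [← h1, ← h2]
  have hpp' : p * p * (b * c) = p := by rw [mul_assoc, h1, ← mul_assoc]; exact h2.symm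
  have hl : c * p * p * b * (c * b) = c * p * b := by
    calc c * p * p * b * (c * b) = c * (p * p * (b * c)) * b := by simp only [mul_assoc]
      _ = c * p * b := by rw [hpp']
  have hr : c * b * (c * p * p * b) = c * p * b := by
    calc c * b * (c * p * p * b) = c * (b * c * p * p) * b := by simp only [mul_assoc]
      _ = c * p * b := by rw [hpp]
  refine ⟨hl.trans hr.symm, ?_, ?_⟩
  · rw [hl]
    calc c * p * p * b = c * p * (b * c * p * p) * b := by rw [hpp]
      _ = c * p * b * (c * p * p * b) := by simp only [mul_assoc]
  · have e : c * b - (c * b) ^ 2 * (c * p * p * b) = c * (b - b * c * p * b) := by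
      rw [sq, mul_assoc, hr, mul_sub]
      simp only [mul_assoc]
    rw [e]
    refine Quasinilpotent.mul_swap ?_
    have e' : (b - b * c * p * b) * c = b * c - (b * c) ^ 2 * p := by
      have e'' : (b * c) ^ 2 * p = b * c * (p * (b * c)) := by rw [sq, mul_assoc, h1]
      rw [e'', sub_mul]
      simp only [mul_assoc]
    rwa [e']

end Sum

/-! ### Transfer to block matrices -/

section BlockMatrix

variable {R : Type*} [NormedRing R] [NormedAlgebra ℂ R] [CompleteSpace R]

/-- Neither side involves a norm on matrices, so the `ℓ^∞` operator norm can be chosen for the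
proof. -/
theorem quasinilpotent_of_notMem_spectrum_matrix {ι : Type*} [Fintype ι] [DecidableEq ι]
    {a : Matrix ι ι R} (ha : ∀ k : ℂ, k ≠ 0 → k ∉ spectrum ℂ a) : Quasinilpotent a := by
  have hcomp : CompleteSpace (Matrix ι ι R) := inferInstance
  exact @quasinilpotent_of_notMem_spectrum (Matrix ι ι R) Matrix.linftyOpNormedRing
    hcomp Matrix.linftyOpNormedAlgebra a ha

theorem Quasinilpotent.blockDiagonal {a d : R} (ha : Quasinilpotent a) (hd : Quasinilpotent d) :
    Quasinilpotent !![a, 0; 0, d] := by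
  refine quasinilpotent_of_notMem_spectrum_matrix fun k hk => ?_
  obtain ⟨u, hu⟩ := spectrum.notMem_iff.1 (ha.notMem_spectrum hk)
  obtain ⟨v, hv⟩ := spectrum.notMem_iff.1 (hd.notMem_spectrum hk)
  have e : algebraMap ℂ (Matrix (Fin 2) (Fin 2) R) k - !![a, 0; 0, d]
      = !![(u : R), 0; 0, (v : R)] := by
    rw [hu, hv]
    ext i j
    fin_cases i <;> fin_cases j <;> simp [Matrix.algebraMap_matrix_apply]
  rw [spectrum.notMem_iff, e, isUnit_iff_exists]
  refine ⟨!![((u⁻¹ : Rˣ) : R), 0; 0, ((v⁻¹ : Rˣ) : R)], ?_, ?_⟩ <;>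
    simp [Matrix.one_fin_two]

theorem IsGDrazinInverse.blockDiagonal {a d x y : R} (ha : IsGDrazinInverse a x)
    (hd : IsGDrazinInverse d y) : IsGDrazinInverse !![a, 0; 0, d] !![x, 0; 0, y] := by
  obtain ⟨a1, a2, a3⟩ := ha
  obtain ⟨d1, d2, d3⟩ := hd
  refine ⟨?_, ?_, ?_⟩
  · simp [a1, d1]
  · simp [← a2, ← d2]
  · convert a3.blockDiagonal d3 using 1
    ext i j
    fin_cases i <;> fin_cases j <;> simp [sq]

theorem IsGDrazinInverse.blockAntidiagonal {b c p : R} (h : IsGDrazinInverse (b * c) p) :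
    IsGDrazinInverse !![0, b; c, 0] !![0, b * (c * p * p * b); c * p, 0] := by
  have h' := h.mul_swap
  obtain ⟨h1, h2, h3⟩ := h
  have hpp : b * c * p * p = p := by rw [← h1, ← h2]
  have hb : b * (c * p * p * b) = p * b := by
    rw [← mul_assoc, ← mul_assoc, ← mul_assoc, hpp]
  rw [hb]
  refine ⟨?_, ?_, ?_⟩
  · simp only [mul_assoc] at h1
    simp [mul_assoc, h1]
  · have e : p * b * c * (p * b) = p * b := by
      rw [← mul_assoc, mul_assoc p b c, ← h2]
    have e' : c * p * b * (c * p) = c * p := by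
      conv_rhs => rw [h2]
      simp only [mul_assoc]
    simp [e, e']
  -- The residual is antidiagonal; its square is block diagonal, with the residuals of `b c` and `c
  -- b` as entries.
  · apply Quasinilpotent.of_sq
    set r := 1 - b * c * p with hr
    have hrr : r * r = r := by
      apply IsIdempotentElem.one_sub
      rw [IsIdempotentElem, mul_assoc, ← mul_assoc p, ← h2]
    have hrs : r * (b * c) = b * c * r := by
      rw [hr, sub_mul, mul_sub, mul_assoc _ p, h1, one_mul, mul_one]
    have e : !![0, b; c, 0] - !![0, b; c, 0] ^ 2 * !![0, p * b; c * p, 0]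
        = !![0, r * b; c * r, 0] := by
      ext i j
      fin_cases i <;> fin_cases j <;> simp [sq, hr, mul_sub, sub_mul, mul_assoc]
    have e1 : r * b * (c * r) = b * c - (b * c) ^ 2 * p := by
      rw [← mul_assoc, mul_assoc r, hrs, mul_assoc, hrr, hr, mul_sub, sq, mul_one]
      simp only [mul_assoc]
    have e2 : c * r * (r * b) = c * b - (c * b) ^ 2 * (c * p * p * b) := by
      have e3 : (c * b) ^ 2 * (c * p * p * b) = c * (b * c * (b * c * p * p)) * b := by
        simp only [sq, mul_assoc]
      rw [mul_assoc, ← mul_assoc r, hrr, e3, hpp, hr]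
      simp only [mul_sub, sub_mul, one_mul, mul_assoc]
    rw [e, Matrix.mul_fin_two, e1, e2]
    simpa using h3.blockDiagonal h'.2.2

theorem IsGDrazinInverse.add_matrix {ι : Type*} [Fintype ι] [DecidableEq ι]
    {a b x y : Matrix ι ι R} {lam : ℂ} (hlam : lam ≠ 0)
    (ha : IsGDrazinInverse a x) (hb : IsGDrazinInverse b y)
    (h : a * b = lam • ((1 - a * x) * b * a * (1 - b * y))) :
    b * x = 0 ∧ y * a = 0 ∧ IsGDrazinInverse (a + b) (x + y) := by
  have hcomp : CompleteSpace (Matrix ι ι R) := inferInstance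
  exact @IsGDrazinInverse.add (Matrix ι ι R) Matrix.linftyOpNormedRing
    Matrix.linftyOpNormedAlgebra hcomp a b x y lam hlam ha hb h

end BlockMatrix

end GDrazin

/-! ### The formula for `M^d` -/

theorem theorem3p3 {𝒜 : Type*} [NormedRing 𝒜] [NormedAlgebra ℂ 𝒜] [CompleteSpace 𝒜]
    (lam : ℂ) (hlam : lam ≠ 0) (A B C D : 𝒜)
    (M P Q : Matrix (Fin 2) (Fin 2) 𝒜)
    (hM : M = !![A, B; C, D]) (hP : P = !![A, 0; 0, D]) (hQ : Q = !![0, B; C, 0])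
    (hA : GDrazin.GDrazinInvertible A) (hD : GDrazin.GDrazinInvertible D)
    (hBC : GDrazin.GDrazinInvertible (B * C))
    (hAB : A * B = lam •
      (GDrazin.spectralIdempotent A * B * D * GDrazin.spectralIdempotent (C * B)))
    (hDC : D * C = lam •
      (GDrazin.spectralIdempotent D * C * A * GDrazin.spectralIdempotent (B * C))) :
    GDrazin.GDrazinInvertible (C * B) ∧
    GDrazin.GDrazinInvertible P ∧
    GDrazin.GDrazinInvertible Q ∧
    GDrazin.GDrazinInvertible M ∧
    Summable (fun n : ℕ =>
      GDrazin.gDrazinInv Q ^ (n + 2) * P * M ^ n * GDrazin.spectralIdempotent P) ∧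
    Summable (fun n : ℕ => M ^ n * Q * GDrazin.gDrazinInv P ^ (n + 2)) ∧
    Summable (fun nk : ℕ × ℕ =>
      GDrazin.gDrazinInv Q ^ (nk.2 + 1) * P * M ^ (nk.1 + nk.2) * Q *
        GDrazin.gDrazinInv P ^ (nk.1 + 2)) ∧
    Summable (fun n : ℕ =>
      GDrazin.gDrazinInv Q ^ (n + 2) * P * M ^ n * Q * GDrazin.gDrazinInv P) ∧
    GDrazin.gDrazinInv M =
      !![GDrazin.spectralIdempotent (B * C) * GDrazin.gDrazinInv A,
          B * GDrazin.gDrazinInv (C * B) * GDrazin.spectralIdempotent D;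
        C * GDrazin.gDrazinInv (B * C) * GDrazin.spectralIdempotent A,
          GDrazin.spectralIdempotent (C * B) * GDrazin.gDrazinInv D]
      + (∑' n : ℕ, GDrazin.gDrazinInv Q ^ (n + 2) * P * M ^ n * GDrazin.spectralIdempotent P)
      + GDrazin.spectralIdempotent Q *
          (∑' n : ℕ, M ^ n * Q * GDrazin.gDrazinInv P ^ (n + 2))
      - (∑' n : ℕ, ∑' k : ℕ,
          GDrazin.gDrazinInv Q ^ (k + 1) * P * M ^ (n + k) * Q * GDrazin.gDrazinInv P ^ (n + 2))
      - (∑' n : ℕ, GDrazin.gDrazinInv Q ^ (n + 2) * P * M ^ n * Q * GDrazin.gDrazinInv P) := by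
  obtain ⟨A', hA'⟩ := hA
  obtain ⟨D', hD'⟩ := hD
  obtain ⟨p, hp⟩ := hBC
  have hCB := hp.mul_swap
  have hPd := hA'.blockDiagonal hD'
  have hQd := hp.blockAntidiagonal
  rw [← hP] at hPd
  rw [← hQ] at hQd
  have gA := GDrazin.gDrazinInv_eq hA'
  have gD := GDrazin.gDrazinInv_eq hD'
  have gBC := GDrazin.gDrazinInv_eq hp
  have gCB := GDrazin.gDrazinInv_eq hCB
  have gP := GDrazin.gDrazinInv_eq_matrix hPd
  have gQ := GDrazin.gDrazinInv_eq_matrix hQd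
  simp only [GDrazin.spectralIdempotent, gA, gD, gBC, gCB] at hAB hDC ⊢
  set q := C * p * p * B
  have hPQ : P * Q = lam • ((1 - P * !![A', 0; 0, D']) * Q * P
      * (1 - Q * !![0, B * q; C * p, 0])) := by
    subst hP hQ
    ext i j
    fin_cases i <;> fin_cases j
    · simp [Matrix.one_fin_two]
    · simpa [Matrix.one_fin_two, mul_assoc] using hAB
    · simpa [Matrix.one_fin_two, mul_assoc] using hDC
    · simp [Matrix.one_fin_two]
  obtain ⟨hQP', hQ'P, hMd⟩ := GDrazin.IsGDrazinInverse.add_matrix hlam hPd hQd hPQ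
  have hMPQ : M = P + Q := by rw [hM, hP, hQ]; simp
  rw [← hMPQ] at hMd
  have gM := GDrazin.gDrazinInv_eq_matrix hMd
  simp only [gP, gQ, gM]
  set X : Matrix (Fin 2) (Fin 2) 𝒜 := !![A', 0; 0, D'] with hX
  set Y : Matrix (Fin 2) (Fin 2) 𝒜 := !![0, B * q; C * p, 0] with hY
  have z1 : ∀ n : ℕ, Y ^ (n + 1) * P = 0 := fun n => by rw [pow_succ, mul_assoc, hQ'P, mul_zero]
  have z2 : ∀ n : ℕ, Q * X ^ (n + 1) = 0 := fun n => by
    rw [pow_succ', ← mul_assoc, hQP', zero_mul]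
  have z2' : ∀ (n : ℕ) (N : Matrix (Fin 2) (Fin 2) 𝒜), N * Q * X ^ (n + 2) = 0 := fun n N => by
    rw [mul_assoc, z2 (n + 1), mul_zero]
  refine ⟨⟨_, hCB⟩, ⟨_, hPd⟩, ⟨_, hQd⟩, ⟨_, hMd⟩, ?_⟩
  simp only [z1, z2', zero_mul, tsum_zero, summable_zero, true_and, mul_zero, add_zero,
    sub_zero]
  have w1 : B * q * D = 0 := by simpa [hP, hY] using congrFun (congrFun hQ'P 0) 1
  have w2 : C * p * A = 0 := by simpa [hP, hY] using congrFun (congrFun hQ'P 1) 0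
  -- `A' = A A'²` brings out the vanishing entry `C p A` of `Q^d P`.
  have v1 : B * C * p * A' = 0 := by
    have : B * C * p * A' = B * (C * p * A) * A' * A' := by
      conv_lhs => rw [hA'.2.1, hA'.1]
      simp only [mul_assoc]
    rw [this, w2]
    simp
  have v2 : C * B * q * D' = 0 := by
    have : C * B * q * D' = C * (B * q * D) * D' * D' := by
      conv_lhs => rw [hD'.2.1, hD'.1]
      simp only [mul_assoc]
    rw [this, w1]
    simp
  rw [hX, hY]
  ext i j
  fin_cases i <;> fin_cases j <;> simp [sub_mul, mul_sub, ← mul_assoc, v1, v2, w1, w2]
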